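/- Let $n\ge 1$ and let $\sigma_x=\begin{pmatrix}0&1\\1&0\end{pmatrix}$, $\sigma_y=\begin{pmatrix}0&-i\\i&0\end{pmatrix}$, $\sigma_z=\begin{pmatrix}1&0\\0&-1\end{pmatrix}$. For complex $2n\times 2n$ matrices $X,Y,H$ define the spectral localizer $$L(X,Y,H)=X\otimes\sigma_x+Y\otimes\sigma_z+H\otimes\sigma_y,$$ a $4n\times 4n$ matrix, with rows and columns ordered so that in block form $L(X,Y,H)=\begin{pmatrix}Y&X-iH\\X+iH&-Y\end{pmatrix}$. Let $\mathcal M_0(\mathcal K,2n)$ be the space (with the topology inherited from $\mathbf M_{2n}(\mathbb C)^3$) of all triples $(X,Y,H)$ of pairwise commuting Hermitian $2n\times 2n$ matrices such that all entries of $X$ and $Y$ are purely imaginary, all entries of $H$ are real, and $L(X,Y,H)$ is invertible. For a skew-symmetric $2k\times 2k$ matrix $A$ let $\mathrm{Pf}(A)=\frac{1}{2^k k!}\sum_{\pi\in S_{2k}}\mathrm{sgn}(\pi)\prod_{i=1}^{k}A_{\pi(2i-1),\pi(2i)}$ be its Pfaffian. Then: 1. For every $(X,Y,H)\in\mathcal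 M_0(\mathcal K,2n)$ the matrix $L(X,Y,H)$ is skew-symmetric and $\mathrm{Pf}(L(X,Y,H))$ is a nonzero real number. 2. Two triples $(X_1,Y_1,H_1),(X_2,Y_2,H_2)\in\mathcal M_0(\mathcal K,2n)$ are connected by a path in $\mathcal M_0(\mathcal K,2n)$ if and only if $\mathrm{sign}\,\mathrm{Pf}(L(X_1,Y_1,H_1))=\mathrm{sign}\,\mathrm{Pf}(L(X_2,Y_2,H_2))$. 3. $\mathcal M_0(\mathcal K,2n)$ has exactly two path components, represented by $(0,0,I)$ and $(0,0,D)$, where $D=\mathrm{diag}(-1,1,\dots,1)$: both triples lie in the space, they are not connected by a path in it, and every triple in the space is connected by a path in it to one of them. -/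

import Mathlib

open scoped Kronecker Nat

noncomputable section

namespace AtomicLimit

/-- The Pauli matrices. -/
def pauliX : Matrix (Fin 2) (Fin 2) ℂ := !![0, 1; 1, 0]

def pauliY : Matrix (Fin 2) (Fin 2) ℂ := !![0, -Complex.I; Complex.I, 0]

def pauliZ : Matrix (Fin 2) (Fin 2) ℂ := !![1, 0; 0, -1]

/-- The Pfaffian `1 / (2^k k!) ∑_σ sgn(σ) ∏_i A_{σ(2i), σ(2i+1)}` (rows and columns numbered from
`0`) of a `2k × 2k` complex matrix; it is used for skew-symmetric matrices only. -/
def pfaffian {k : ℕ} (A : Matrix (Fin (2 * k)) (Fin (2 * k)) ℂ) : ℂ :=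
  ((2 : ℂ) ^ k * (k ! : ℂ))⁻¹ *
    ∑ σ : Equiv.Perm (Fin (2 * k)), ((Equiv.Perm.sign σ : ℤ) : ℂ) *
      ∏ i : Fin k, A (σ ⟨2 * (i : ℕ), by omega⟩) (σ ⟨2 * (i : ℕ) + 1, by omega⟩)

/-- Triples `(X, Y, H)` of complex `2n × 2n` matrices, with the usual (product) topology. -/
abbrev Triple (n : ℕ) : Type :=
  Matrix (Fin (2 * n)) (Fin (2 * n)) ℂ × Matrix (Fin (2 * n)) (Fin (2 * n)) ℂ ×
    Matrix (Fin (2 * n)) (Fin (2 * n)) ℂ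

/-- The spectral localizer `X ⊗ σx + Y ⊗ σz + H ⊗ σy` of a triple `(X, Y, H)`. Its rows and columns
are numbered so that, as a block matrix, it is `[[Y, X - iH], [X + iH, -Y]]`: the index `(i, s)` of
the tensor product gets the number `i + 2n s`. -/
def localizer {n : ℕ} (T : Triple n) : Matrix (Fin (2 * (2 * n))) (Fin (2 * (2 * n))) ℂ :=
  Matrix.reindex ((Equiv.prodComm (Fin (2 * n)) (Fin 2)).trans finProdFinEquiv)
    ((Equiv.prodComm (Fin (2 * n)) (Fin 2)).trans finProdFinEquiv)
    (T.1 ⊗ₖ pauliX + T.2.1 ⊗ₖ pauliZ + T.2.2 ⊗ₖ pauliY)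

/-- The space `M₀(K, 2n)` of atomic limits: commuting Hermitian triples `(X, Y, H)` with `X`, `Y`
purely imaginary, `H` real, and invertible spectral localizer. -/
def atomicLimits (n : ℕ) : Set (Triple n) :=
  {T | T.1.IsHermitian ∧ T.2.1.IsHermitian ∧ T.2.2.IsHermitian ∧
    (∀ i j, (T.1 i j).re = 0) ∧ (∀ i j, (T.2.1 i j).re = 0) ∧ (∀ i j, (T.2.2 i j).im = 0) ∧
    Commute T.1 T.2.1 ∧ Commute T.1 T.2.2 ∧ Commute T.2.1 T.2.2 ∧
    IsUnit (localizer T)}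

/-- The sign of the Pfaffian of the spectral localizer (a real number on `atomicLimits n`). -/
def pfaffianSign {n : ℕ} (T : Triple n) : SignType :=
  SignType.sign (pfaffian (localizer T)).re

/-- The triple `(0, 0, I)`. -/
def trivialTriple (n : ℕ) : Triple n := (0, 0, 1)

/-- The triple `(0, 0, D)` with `D = diag(-1, 1, …, 1)`. -/
def nontrivialTriple (n : ℕ) : Triple n :=
  (0, 0, Matrix.diagonal fun i : Fin (2 * n) => if (i : ℕ) = 0 then -1 else 1)

end AtomicLimit

end

noncomputable section

namespace AtomicLimit

open Matrix Equiv Filter Topology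


/-! Commutation gives `L² = (X² + Y² + H²) ⊗ 1`, so the localizer is invertible exactly when `X`,
`Y`, `H` have no common kernel vector (`mem_atomicLimits_iff`). This makes deformations easy to
control. With `S = X² + Y²` the matrix `H + iS` is invertible, hence so is `H + cS` for some real
`c`; shrinking `X`, `Y` while adding `cS` to `H` leads to a triple `(0, 0, H')`
(`exists_joinedIn_zero_zero`). A real orthogonal matrix diagonalizes `H'`, the eigenvalues move to
`±1`, and the `-1`s cancel in pairs: two of them cross zero together while an imaginary `X` on their
plane keeps the kernel trivial (`joinedIn_signVector_erase`). What remains is `I` or a reflection `1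
- 2uuᵀ`, and all reflections are connected because the unit sphere of `ℝ^(2n)` is.

Conversely, the Pfaffian is real and continuous, so its sign is constant on paths once it never
vanishes. This is shown without `Pf² = det`: nearby invertible skew-symmetric matrices are congruent
(`eventually_congruent`) and `Pf(KAKᵀ) = det K · Pf A` (`pairPf_congruence`), so nonvanishing is
locally constant along paths and is inherited from the two base points. Their Pfaffians differ by
the factor `det D = -1`, so the sign separates them. -/

/-- The unnormalized Pfaffian of a matrix whose index set is a union of pairs. -/
def pairPf {ι : Type*} [Fintype ι] [DecidableEq ι] (A : Matrix (ι × Fin 2) (ι × Fin 2) ℂ) : ℂ :=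
  ∑ σ : Perm (ι × Fin 2), ((Perm.sign σ : ℤ) : ℂ) * ∏ i, A (σ (i, 0)) (σ (i, 1))

/-! ### Pfaffians: congruence, the standard skew form, reality -/

section pairPf

variable {ι : Type*} [Fintype ι] [DecidableEq ι]

/-- A function on pairs is a pair of functions. -/
def pairFunEquiv (ι κ : Type*) : (ι × Fin 2 → κ) ≃ (ι → κ × κ) where
  toFun g i := (g (i, 0), g (i, 1))
  invFun f p := if p.2 = 0 then (f p.1).1 else (f p.1).2
  left_inv g := by
    funext ⟨i, s⟩
    fin_cases s <;> simp
  right_inv f := by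
    funext i
    simp

theorem det_submatrix_of_not_bijective {κ : Type*} [Fintype κ] [DecidableEq κ]
    (B : Matrix κ κ ℂ) {g : κ → κ} (hg : ¬ Function.Bijective g) :
    (B.submatrix id g).det = 0 := by
  rw [← Finite.injective_iff_bijective, Function.Injective] at hg
  push Not at hg
  obtain ⟨i, j, hij, hne⟩ := hg
  exact det_zero_of_column_eq hne fun k => by simp [hij]

/-- Expanding every entry of `B A Bᵀ` turns the sum over `σ` into a determinant of columns of `B`
chosen by a map `g`. A non-injective `g` repeats a column and contributes zero; a permutation `g`
contributes `sgn g · det B`. -/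
theorem pairPf_congruence (B A : Matrix (ι × Fin 2) (ι × Fin 2) ℂ) :
    pairPf (B * A * Bᵀ) = B.det * pairPf A := by
  have hterm (u v : ι × Fin 2) : (B * A * Bᵀ) u v =
      ∑ q : (ι × Fin 2) × (ι × Fin 2), A q.1 q.2 * (B u q.1 * B v q.2) := by
    rw [Fintype.sum_prod_type]
    simp only [mul_apply, transpose_apply, Finset.sum_mul]
    rw [Finset.sum_comm]
    refine Finset.sum_congr rfl fun a _ => Finset.sum_congr rfl fun b _ => by ring
  calc pairPf (B * A * Bᵀ)
      = ∑ σ : Perm (ι × Fin 2), ∑ f : ι → (ι × Fin 2) × (ι × Fin 2),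
          (∏ i, A (f i).1 (f i).2) * (((Perm.sign σ : ℤ) : ℂ) *
            ∏ i, (B (σ (i, 0)) (f i).1 * B (σ (i, 1)) (f i).2)) := by
        unfold pairPf
        refine Finset.sum_congr rfl fun σ _ => ?_
        simp only [hterm]
        rw [Finset.prod_univ_sum, Fintype.piFinset_univ, Finset.mul_sum]
        refine Finset.sum_congr rfl fun f _ => ?_
        rw [Finset.prod_mul_distrib]
        ring
    _ = ∑ g : ι × Fin 2 → ι × Fin 2,
          (∏ i, A (g (i, 0)) (g (i, 1))) * (B.submatrix id g).det := by
        rw [Finset.sum_comm]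
        refine (Fintype.sum_equiv (pairFunEquiv ι (ι × Fin 2)) _ _ fun g => ?_).symm
        rw [← Finset.mul_sum, det_apply']
        congr 1
        refine Finset.sum_congr rfl fun σ _ => ?_
        simp [Fintype.prod_prod_type, Fin.prod_univ_two, pairFunEquiv]
    _ = ∑ τ : Perm (ι × Fin 2),
          (∏ i, A (τ (i, 0)) (τ (i, 1))) * (B.submatrix id τ).det := by
        symm
        refine Finset.sum_of_injOn (fun τ => (τ : ι × Fin 2 → ι × Fin 2))
          (fun _ _ _ _ h => DFunLike.coe_injective h) (fun _ _ => by simp) ?_ (fun _ _ => rfl)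
        intro g _ hg
        rw [det_submatrix_of_not_bijective, mul_zero]
        intro hb
        exact hg ⟨Equiv.ofBijective g hb, by simp, rfl⟩
    _ = B.det * pairPf A := by
        unfold pairPf
        rw [Finset.mul_sum]
        refine Finset.sum_congr rfl fun τ _ => ?_
        rw [det_permute']
        ring

theorem pairPf_continuous : Continuous (pairPf : Matrix (ι × Fin 2) (ι × Fin 2) ℂ → ℂ) := by
  unfold pairPf
  fun_prop

/-- The matrix `[[0, -i], [i, 0]]` repeated along the diagonal. -/
def standardSkew (ι : Type*) [DecidableEq ι] : Matrix (ι × Fin 2) (ι × Fin 2) ℂ :=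
  (1 : Matrix ι ι ℂ) ⊗ₖ pauliY

theorem pauliY_perm (e : Perm (Fin 2)) :
    pauliY (e 0) (e 1) = ((Perm.sign e : ℤ) : ℂ) * (-Complex.I) := by
  have h : e = 1 ∨ e = swap 0 1 := by
    revert e
    decide
  rcases h with rfl | rfl <;> simp [pauliY]

/-- A nonzero term comes from a `σ` that maps pairs to pairs. It is then a permutation of the pairs,
of sign `1` because it acts on both slots, composed with flips inside pairs, whose signs cancel
against those of the entries. Hence no two terms of the Pfaffian cancel. -/
theorem standardSkew_term (σ : Perm (ι × Fin 2)) :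
    ((Perm.sign σ : ℤ) : ℂ) * ∏ i, standardSkew ι (σ (i, 0)) (σ (i, 1)) = 0 ∨
    ((Perm.sign σ : ℤ) : ℂ) * ∏ i, standardSkew ι (σ (i, 0)) (σ (i, 1)) =
      (-Complex.I) ^ Fintype.card ι := by
  by_cases h : ∀ i, standardSkew ι (σ (i, 0)) (σ (i, 1)) ≠ 0
  swap
  · push Not at h
    obtain ⟨i, hi⟩ := h
    left
    rw [Finset.prod_eq_zero (Finset.mem_univ i) hi, mul_zero]
  right
  have hfst (i : ι) : (σ (i, 1)).1 = (σ (i, 0)).1 := by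
    by_contra hne
    exact h i (by simp [standardSkew, kroneckerMap_apply, one_apply_ne (Ne.symm hne)])
  have hsnd (i : ι) : (σ (i, 0)).2 ≠ (σ (i, 1)).2 := by
    intro heq
    have := σ.injective (Prod.ext (hfst i).symm heq)
    simp at this
  have hinj (i : ι) : Function.Injective fun s => (σ (i, s)).2 := by
    intro s t hst
    fin_cases s <;> fin_cases t <;> first | rfl | skip
    · exact absurd hst (hsnd i)
    · exact absurd hst.symm (hsnd i)
  let e (i : ι) : Perm (Fin 2) := Equiv.ofBijective _ (Finite.injective_iff_bijective.1 (hinj i))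
  have hfst' (i : ι) (s : Fin 2) : (σ (i, s)).1 = (σ (i, 0)).1 := by
    fin_cases s
    · rfl
    · exact hfst i
  -- If two pairs had the same image pair, the image of `(i, 0)` would already be attained on the
  -- pair of `j`.
  have hπ : Function.Injective fun i => (σ (i, 0)).1 := by
    intro i j hij
    obtain ⟨s, hs⟩ := (e j).surjective ((σ (i, 0)).2)
    have := σ.injective (a₁ := (i, 0)) (a₂ := (j, s))
      (Prod.ext (by rw [hfst' j s]; exact hij) hs.symm)
    exact congrArg Prod.fst this
  let π : Perm ι := Equiv.ofBijective _ (Finite.injective_iff_bijective.1 hπ)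
  have hσ : σ = (prodCongrLeft fun _ : Fin 2 => π) * prodCongrRight e := by
    ext1 ⟨i, s⟩
    exact Prod.ext (hfst' i s) rfl
  have hsign : Perm.sign σ = ∏ i, Perm.sign (e i) := by
    rw [hσ, Perm.sign_mul, Perm.sign_prodCongrLeft, Perm.sign_prodCongrRight]
    simp
  have hprod : ∏ i, standardSkew ι (σ (i, 0)) (σ (i, 1)) =
      ∏ i, (((Perm.sign (e i) : ℤ) : ℂ) * (-Complex.I)) := by
    refine Finset.prod_congr rfl fun i _ => ?_
    rw [← pauliY_perm]
    simp [standardSkew, kroneckerMap_apply, one_apply, hfst i, e]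
  rw [hprod, Finset.prod_mul_distrib, hsign, ← mul_assoc]
  simp only [Finset.prod_const, Finset.card_univ]
  push_cast
  rw [← Finset.prod_mul_distrib]
  have : ∀ i, (((Perm.sign (e i) : ℤ) : ℂ)) * ((Perm.sign (e i) : ℤ) : ℂ) = 1 := by
    intro i
    rw [← Int.cast_mul, ← Units.val_mul, Int.units_mul_self]
    simp
  simp [this]

theorem pairPf_standardSkew_ne_zero : pairPf (standardSkew ι) ≠ 0 := by
  classical
  let term (σ : Perm (ι × Fin 2)) : ℂ :=
    ((Perm.sign σ : ℤ) : ℂ) * ∏ i, standardSkew ι (σ (i, 0)) (σ (i, 1))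
  let c : ℂ := (-Complex.I) ^ Fintype.card ι
  have hc : c ≠ 0 := pow_ne_zero _ (neg_ne_zero.2 Complex.I_ne_zero)
  have hone : term 1 = c := by
    simp [term, c, standardSkew, kroneckerMap_apply, one_apply, pauliY]
  have hsum : pairPf (standardSkew ι) =
      ((Finset.univ.filter fun σ => term σ = c).card : ℂ) * c := by
    change ∑ σ, term σ = _
    rw [← nsmul_eq_mul, ← Finset.sum_const, Finset.sum_filter]
    refine Finset.sum_congr rfl fun σ _ => ?_
    split_ifs with h
    · exact h
    · exact (standardSkew_term σ).resolve_right h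
  rw [hsum]
  refine mul_ne_zero (Nat.cast_ne_zero.2 ?_) hc
  exact Finset.card_ne_zero_of_mem (a := 1) (by simpa using hone)

/-- Each product has one imaginary factor per pair, so conjugation gives one sign per pair. For the
localizer the number of pairs is `2n`, and the Pfaffian is real. -/
theorem star_pairPf (A : Matrix (ι × Fin 2) (ι × Fin 2) ℂ) (hA : ∀ p q, star (A p q) = -A p q) :
    star (pairPf A) = (-1) ^ Fintype.card ι * pairPf A := by
  unfold pairPf
  rw [star_sum, Finset.mul_sum]
  refine Finset.sum_congr rfl fun σ _ => ?_
  rw [star_mul', star_prod]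
  simp only [hA]
  rw [Finset.prod_neg]
  simp
  ring

end pairPf


/-! ### Local congruence of skew-symmetric matrices -/

/-- In a Banach algebra, elements close to `1` have a square root close to `1`, unique there. -/
theorem exists_local_sqrt (𝔸 : Type*) [NormedRing 𝔸] [NormedAlgebra ℝ 𝔸] [CompleteSpace 𝔸] :
    ∃ s : 𝔸 → 𝔸, Tendsto s (𝓝 1) (𝓝 1) ∧ (∀ᶠ y in 𝓝 (1 : 𝔸), s y * s y = y) ∧
      ∀ᶠ x in 𝓝 (1 : 𝔸), s (x * x) = x := by
  -- Squaring has derivative `2 • id` at `1`, so the inverse function theorem applies.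
  let f' : 𝔸 ≃L[ℝ] 𝔸 := ContinuousLinearEquiv.smulLeft (Units.mk0 (2 : ℝ) two_ne_zero)
  have hf : HasStrictFDerivAt (fun x : 𝔸 => x * x) (f' : 𝔸 →L[ℝ] 𝔸) 1 := by
    have h := (hasStrictFDerivAt_id (𝕜 := ℝ) (1 : 𝔸)).mul' (hasStrictFDerivAt_id (1 : 𝔸))
    refine h.congr_fderiv ?_
    ext x
    change (1 : 𝔸) * x + x * 1 = (2 : ℝ) • x
    rw [one_mul, mul_one, two_smul]
  refine ⟨hf.localInverse _ _ _, ?_, ?_, hf.eventually_left_inverse⟩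
  · have h := hf.localInverse_tendsto
    simpa using h
  · simpa using hf.eventually_right_inverse

/-- The operator norm is auxiliary: only the matrix topology enters the conclusion. -/
theorem exists_matrix_local_sqrt (κ : Type*) [Fintype κ] [DecidableEq κ] :
    ∃ s : Matrix κ κ ℂ → Matrix κ κ ℂ, Tendsto s (𝓝 1) (𝓝 1) ∧
      (∀ᶠ y in 𝓝 (1 : Matrix κ κ ℂ), s y * s y = y) ∧
      ∀ᶠ x in 𝓝 (1 : Matrix κ κ ℂ), s (x * x) = x := by
  let _ : NormedRing (Matrix κ κ ℂ) := Matrix.linftyOpNormedRing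
  let _ : NormedAlgebra ℝ (Matrix κ κ ℂ) := Matrix.linftyOpNormedAlgebra
  exact AtomicLimit.exists_local_sqrt (Matrix κ κ ℂ)

/-- A skew-symmetric matrix close to an invertible one is congruent to it. -/
theorem eventually_congruent {κ : Type*} [Fintype κ] [DecidableEq κ] (A₀ : Matrix κ κ ℂ)
    (h₀ : A₀ᵀ = -A₀) (hu : IsUnit A₀) :
    ∀ᶠ A in 𝓝 A₀, Aᵀ = -A → IsUnit A → ∃ K : Matrix κ κ ℂ, K.det ≠ 0 ∧ A = K * A₀ * Kᵀ := by
  obtain ⟨s, hs, hsq, hinj⟩ := exists_matrix_local_sqrt κ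
  obtain ⟨C, hC₁, hC₂⟩ : ∃ C, A₀ * C = 1 ∧ C * A₀ = 1 := by
    obtain ⟨u, rfl⟩ := hu
    exact ⟨(u⁻¹ : (Matrix κ κ ℂ)ˣ), by simp, by simp⟩
  -- With `C = A₀⁻¹`, `τ` is the anti-automorphism of transposition twisted by `A₀`. It fixes `A C`
  -- for skew `A`, so by uniqueness it also fixes the square root `K` of `A C`; then `K A₀ Kᵀ = K
  -- τ(K) A₀ = K² A₀ = A`.
  obtain ⟨τ, τ_def⟩ : ∃ τ : Matrix κ κ ℂ → Matrix κ κ ℂ, ∀ K, τ K = A₀ * Kᵀ * C := ⟨_, fun _ => rfl⟩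
  have hτ : Continuous τ := by
    simp only [funext τ_def]
    exact (continuous_const.matrix_mul continuous_id.matrix_transpose).matrix_mul continuous_const
  have hτ₁ : τ 1 = 1 := by simp [τ_def, hC₁]
  have hN : Tendsto (fun A => A * C) (𝓝 A₀) (𝓝 1) := by
    rw [← hC₁]
    exact (continuous_id.mul continuous_const).tendsto A₀
  have hτs : Tendsto (fun A => τ (s (A * C))) (𝓝 A₀) (𝓝 1) := by
    have := hτ.tendsto 1
    rw [hτ₁] at this
    exact this.comp (hs.comp hN)
  filter_upwards [hN.eventually hsq, hτs.eventually hinj] with A h₁ h₂ hA hAu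
  set K := s (A * C) with hK
  have hτmul : τ K * τ K = τ (K * K) := by
    simp only [τ_def, transpose_mul]
    calc A₀ * Kᵀ * C * (A₀ * Kᵀ * C) = A₀ * Kᵀ * (C * A₀) * Kᵀ * C := by noncomm_ring
      _ = _ := by rw [hC₂]; noncomm_ring
  have hCt : Cᵀ = -C := by
    have h : A₀ * Cᵀ = -1 := by
      have := congrArg transpose hC₂
      rw [transpose_mul, h₀, transpose_one, Matrix.neg_mul] at this
      rw [← this, neg_neg]
    calc Cᵀ = C * (A₀ * Cᵀ) := by rw [← Matrix.mul_assoc, hC₂, Matrix.one_mul]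
      _ = -C := by rw [h, Matrix.mul_neg, Matrix.mul_one]
  have hτN : τ (A * C) = A * C := by
    simp only [τ_def, transpose_mul, hCt, hA]
    rw [_root_.neg_mul_neg, ← Matrix.mul_assoc, hC₁, Matrix.one_mul]
  have hτK : τ K = K := by
    rw [← h₂, hτmul, h₁, hτN]
  have hA' : A = K * A₀ * Kᵀ := by
    calc A = K * K * A₀ := by rw [h₁, Matrix.mul_assoc, hC₂, Matrix.mul_one]
      _ = K * τ K * A₀ := by rw [hτK]
      _ = K * A₀ * Kᵀ * (C * A₀) := by simp only [τ_def]; noncomm_ring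
      _ = _ := by rw [hC₂, Matrix.mul_one]
  refine ⟨K, fun h => ?_, hA'⟩
  have := ((isUnit_iff_isUnit_det A).1 hAu).ne_zero
  rw [hA', det_mul, det_mul, h] at this
  simp at this

/-- Along a path of invertible skew-symmetric matrices the Pfaffian vanishes everywhere or
nowhere. -/
theorem pairPf_ne_zero_of_path {ι : Type*} [Fintype ι] [DecidableEq ι]
    (γ : unitInterval → Matrix (ι × Fin 2) (ι × Fin 2) ℂ) (hγ : Continuous γ)
    (hskew : ∀ t, (γ t)ᵀ = -γ t) (hu : ∀ t, IsUnit (γ t)) (h : pairPf (γ 1) ≠ 0) :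
    pairPf (γ 0) ≠ 0 := by
  have hloc : IsLocallyConstant fun t => pairPf (γ t) ≠ 0 := by
    rw [IsLocallyConstant.iff_eventually_eq]
    intro t
    filter_upwards [(hγ.tendsto t).eventually (eventually_congruent (γ t) (hskew t) (hu t))]
      with r hr
    obtain ⟨K, hK, hKr⟩ := hr (hskew r) (hu r)
    rw [hKr, pairPf_congruence]
    simp [hK]
  have := hloc.apply_eq_of_preconnectedSpace 0 1
  exact (Eq.to_iff this).2 h

/-! ### Comparison of the two numberings of pairs -/

/-- The numbering of pairs by which the localizer is written as a block matrix. -/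
def blockEquiv (k : ℕ) : Fin k × Fin 2 ≃ Fin (2 * k) :=
  (Equiv.prodComm (Fin k) (Fin 2)).trans finProdFinEquiv

/-- The numbering of pairs by consecutive numbers. -/
def consecutiveEquiv (k : ℕ) : Fin k × Fin 2 ≃ Fin (2 * k) :=
  finProdFinEquiv.trans (finCongr (Nat.mul_comm k 2))

/-- Renumbering only multiplies by the sign of a fixed permutation. The constant need not be
computed: it is real, nonzero and independent of `A`, which suffices for comparing signs. -/
theorem exists_pfaffian_reindex (k : ℕ) : ∃ c : ℝ, c ≠ 0 ∧
    ∀ A : Matrix (Fin k × Fin 2) (Fin k × Fin 2) ℂ,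
      pfaffian (reindex (blockEquiv k) (blockEquiv k) A) = c * pairPf A := by
  let e := consecutiveEquiv k
  let b := blockEquiv k
  refine ⟨((2 : ℝ) ^ k * (k ! : ℝ))⁻¹ * ((Perm.sign (e.symm.trans b) : ℤ) : ℝ), ?_, fun A => ?_⟩
  · refine mul_ne_zero (inv_ne_zero ?_) ?_
    · positivity
    · exact_mod_cast (Perm.sign (e.symm.trans b)).ne_zero
  · unfold pfaffian pairPf
    push_cast
    rw [mul_assoc]
    congr 1
    rw [Finset.mul_sum]
    symm
    refine Fintype.sum_equiv (e.equivCongr b) _ _ fun σ => ?_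
    rw [Perm.sign_equivCongr]
    have h0 (i : Fin k) : e.symm ⟨2 * (i : ℕ), by omega⟩ = (i, 0) := by
      rw [symm_apply_eq]
      ext
      simp [e, consecutiveEquiv]
    have h1 (i : Fin k) : e.symm ⟨2 * (i : ℕ) + 1, by omega⟩ = (i, 1) := by
      rw [symm_apply_eq]
      ext
      simp [e, consecutiveEquiv]
      omega
    have hprod : ∀ i : Fin k, reindex b b A ((e.equivCongr b) σ ⟨2 * (i : ℕ), by omega⟩)
        ((e.equivCongr b) σ ⟨2 * (i : ℕ) + 1, by omega⟩) = A (σ (i, 0)) (σ (i, 1)) := by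
      intro i
      simp [h0, h1]
    rw [Finset.prod_congr rfl fun i _ => hprod i]
    push_cast
    ring


/-! ### Algebra of the localizer and the common-kernel criterion -/

/-- The triples satisfying every condition on atomic limits except invertibility. -/
def symmetricTriples (n : ℕ) : Set (Triple n) :=
  {T | T.1.IsHermitian ∧ T.2.1.IsHermitian ∧ T.2.2.IsHermitian ∧
    (∀ i j, (T.1 i j).re = 0) ∧ (∀ i j, (T.2.1 i j).re = 0) ∧ (∀ i j, (T.2.2 i j).im = 0) ∧
    Commute T.1 T.2.1 ∧ Commute T.1 T.2.2 ∧ Commute T.2.1 T.2.2}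

/-- The localizer with rows and columns indexed by the tensor product. -/
def pairLocalizer {n : ℕ} (T : Triple n) : Matrix (Fin (2 * n) × Fin 2) (Fin (2 * n) × Fin 2) ℂ :=
  T.1 ⊗ₖ pauliX + T.2.1 ⊗ₖ pauliZ + T.2.2 ⊗ₖ pauliY

theorem localizer_eq_reindex {n : ℕ} (T : Triple n) :
    localizer T = reindex (blockEquiv (2 * n)) (blockEquiv (2 * n)) (pairLocalizer T) := rfl

theorem transpose_eq_neg_of_re_eq_zero {κ : Type*} {A : Matrix κ κ ℂ} (h : A.IsHermitian)
    (hre : ∀ i j, (A i j).re = 0) : Aᵀ = -A := by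
  ext i j
  have h1 := congrFun (congrFun h j) i
  have h2 := hre i j
  rw [conjTranspose_apply] at h1
  rw [transpose_apply, Matrix.neg_apply, ← h1]
  apply Complex.ext <;> simp [h2]

theorem transpose_eq_self_of_im_eq_zero {κ : Type*} {A : Matrix κ κ ℂ} (h : A.IsHermitian)
    (him : ∀ i j, (A i j).im = 0) : Aᵀ = A := by
  ext i j
  have h1 := congrFun (congrFun h j) i
  have h2 := him i j
  rw [conjTranspose_apply] at h1
  rw [transpose_apply, ← h1]
  apply Complex.ext <;> simp [h2]

theorem pauliX_transpose : pauliXᵀ = pauliX := by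
  ext i j; fin_cases i <;> fin_cases j <;> simp [pauliX]

theorem pauliY_transpose : pauliYᵀ = -pauliY := by
  ext i j; fin_cases i <;> fin_cases j <;> simp [pauliY]

theorem pauliZ_transpose : pauliZᵀ = pauliZ := by
  ext i j; fin_cases i <;> fin_cases j <;> simp [pauliZ]

theorem pauliX_conjTranspose : pauliXᴴ = pauliX := by
  ext i j; fin_cases i <;> fin_cases j <;> simp [pauliX]

theorem pauliY_conjTranspose : pauliYᴴ = pauliY := by
  ext i j; fin_cases i <;> fin_cases j <;> simp [pauliY]

theorem pauliZ_conjTranspose : pauliZᴴ = pauliZ := by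
  ext i j; fin_cases i <;> fin_cases j <;> simp [pauliZ]

theorem pauliX_mul_self : pauliX * pauliX = 1 := by
  ext i j; fin_cases i <;> fin_cases j <;> simp [pauliX]

theorem pauliY_mul_self : pauliY * pauliY = 1 := by
  ext i j; fin_cases i <;> fin_cases j <;> simp [pauliY]

theorem pauliZ_mul_self : pauliZ * pauliZ = 1 := by
  ext i j; fin_cases i <;> fin_cases j <;> simp [pauliZ]

theorem pauliZ_mul_pauliX : pauliZ * pauliX = -(pauliX * pauliZ) := by
  ext i j; fin_cases i <;> fin_cases j <;> simp [pauliX, pauliZ]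

theorem pauliY_mul_pauliX : pauliY * pauliX = -(pauliX * pauliY) := by
  ext i j; fin_cases i <;> fin_cases j <;> simp [pauliX, pauliY]

theorem pauliY_mul_pauliZ : pauliY * pauliZ = -(pauliZ * pauliY) := by
  ext i j; fin_cases i <;> fin_cases j <;> simp [pauliZ, pauliY]

theorem kronecker_neg' {κ μ : Type*} (A : Matrix κ κ ℂ) (B : Matrix μ μ ℂ) :
    A ⊗ₖ (-B) = -(A ⊗ₖ B) := by
  ext; simp [kroneckerMap_apply]

theorem neg_kronecker' {κ μ : Type*} (A : Matrix κ κ ℂ) (B : Matrix μ μ ℂ) :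
    (-A) ⊗ₖ B = -(A ⊗ₖ B) := by
  ext; simp [kroneckerMap_apply]

variable {n : ℕ}

theorem pairLocalizer_transpose {T : Triple n} (hT : T ∈ symmetricTriples n) :
    (pairLocalizer T)ᵀ = -pairLocalizer T := by
  obtain ⟨hX, hY, hH, rX, rY, rH, -⟩ := hT
  simp only [pairLocalizer, transpose_add, ← kroneckerMap_transpose,
    transpose_eq_neg_of_re_eq_zero hX rX, transpose_eq_neg_of_re_eq_zero hY rY,
    transpose_eq_self_of_im_eq_zero hH rH, pauliX_transpose, pauliY_transpose, pauliZ_transpose,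
    kronecker_neg', neg_kronecker']
  abel

theorem pairLocalizer_isHermitian {T : Triple n} (hT : T ∈ symmetricTriples n) :
    (pairLocalizer T).IsHermitian := by
  obtain ⟨hX, hY, hH, -⟩ := hT
  rw [IsHermitian, pairLocalizer, conjTranspose_add, conjTranspose_add, conjTranspose_kronecker,
    conjTranspose_kronecker, conjTranspose_kronecker, hX, hY, hH, pauliX_conjTranspose,
    pauliY_conjTranspose, pauliZ_conjTranspose]

theorem star_pairLocalizer {T : Triple n} (hT : T ∈ symmetricTriples n)
    (p q : Fin (2 * n) × Fin 2) : star (pairLocalizer T p q) = -pairLocalizer T p q := by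
  rw [← Matrix.neg_apply, ← pairLocalizer_transpose hT, transpose_apply]
  exact congrFun (congrFun (pairLocalizer_isHermitian hT) q) p

/-- The Pauli matrices anticommute and square to `1`, so for commuting `X`, `Y`, `H` all cross terms
cancel. -/
theorem pairLocalizer_mul_self {T : Triple n} (hT : T ∈ symmetricTriples n) :
    pairLocalizer T * pairLocalizer T =
      (T.1 * T.1 + T.2.1 * T.2.1 + T.2.2 * T.2.2) ⊗ₖ (1 : Matrix (Fin 2) (Fin 2) ℂ) := by
  obtain ⟨-, -, -, -, -, -, hXY, hXH, hYH⟩ := hT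
  simp only [pairLocalizer, add_mul, mul_add, ← mul_kronecker_mul, pauliX_mul_self,
    pauliY_mul_self, pauliZ_mul_self, pauliZ_mul_pauliX, pauliY_mul_pauliX, pauliY_mul_pauliZ,
    ← hXY.eq, ← hXH.eq, ← hYH.eq, kronecker_neg', add_kronecker]
  abel

theorem isUnit_iff_forall_mulVec {κ : Type*} [Fintype κ] [DecidableEq κ] (A : Matrix κ κ ℂ) :
    IsUnit A ↔ ∀ v, A *ᵥ v = 0 → v = 0 := by
  rw [isUnit_iff_isUnit_det, isUnit_iff_ne_zero, ne_eq, ← exists_mulVec_eq_zero_iff]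
  push Not
  exact ⟨fun h v hv => by_contra fun h0 => h v h0 hv, fun h v h0 hv => h0 (h v hv)⟩

open scoped ComplexOrder in
/-- The kernel of a sum of squares of Hermitian matrices is the intersection of the kernels. -/
theorem sum_squares_mulVec_eq_zero {κ : Type*} [Fintype κ] {X Y H : Matrix κ κ ℂ}
    (hX : X.IsHermitian) (hY : Y.IsHermitian) (hH : H.IsHermitian) {v : κ → ℂ}
    (h : (X * X + Y * Y + H * H) *ᵥ v = 0) : X *ᵥ v = 0 ∧ Y *ᵥ v = 0 ∧ H *ᵥ v = 0 := by
  have key {A : Matrix κ κ ℂ} (hA : A.IsHermitian) :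
      star v ⬝ᵥ ((A * A) *ᵥ v) = star (A *ᵥ v) ⬝ᵥ (A *ᵥ v) := by
    rw [← mulVec_mulVec, dotProduct_mulVec, star_mulVec, hA]
  have h0 : star v ⬝ᵥ ((X * X + Y * Y + H * H) *ᵥ v) = 0 := by rw [h, dotProduct_zero]
  rw [add_mulVec, add_mulVec, dotProduct_add, dotProduct_add, key hX, key hY, key hH] at h0
  have pX := dotProduct_star_self_nonneg (X *ᵥ v)
  have pY := dotProduct_star_self_nonneg (Y *ᵥ v)
  have pH := dotProduct_star_self_nonneg (H *ᵥ v)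
  rw [add_eq_zero_iff_of_nonneg (add_nonneg pX pY) pH, add_eq_zero_iff_of_nonneg pX pY] at h0
  simpa only [dotProduct_star_self_eq_zero, and_assoc] using h0

theorem mem_atomicLimits_iff {T : Triple n} : T ∈ atomicLimits n ↔ T ∈ symmetricTriples n ∧
    ∀ v, T.1 *ᵥ v = 0 → T.2.1 *ᵥ v = 0 → T.2.2 *ᵥ v = 0 → v = 0 := by
  have h1 : T ∈ atomicLimits n ↔ T ∈ symmetricTriples n ∧ IsUnit (localizer T) := by
    simp only [atomicLimits, symmetricTriples, Set.mem_ofPred_eq, and_assoc]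
  rw [h1]
  refine and_congr_right fun hT => ?_
  have h2 : IsUnit (localizer T) ↔
      IsUnit (T.1 * T.1 + T.2.1 * T.2.1 + T.2.2 * T.2.2) := by
    rw [isUnit_iff_isUnit_det, localizer_eq_reindex, det_reindex_self, isUnit_iff_isUnit_det]
    have := congrArg det (pairLocalizer_mul_self hT)
    rw [det_mul, det_kronecker, det_one, one_pow, mul_one] at this
    rw [← isUnit_pow_iff (a := (T.1 * T.1 + T.2.1 * T.2.1 + T.2.2 * T.2.2).det)
      (n := Fintype.card (Fin 2)) (by simp), ← this, IsUnit.mul_iff, and_self]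
  rw [h2, isUnit_iff_forall_mulVec]
  constructor
  · intro h v hX hY hH
    apply h
    simp only [add_mulVec, ← mulVec_mulVec, hX, hY, hH, mulVec_zero, add_zero]
  · intro h v hv
    obtain ⟨hX, hY, hH⟩ := sum_squares_mulVec_eq_zero hT.1 hT.2.1 hT.2.2.1 hv
    exact h v hX hY hH

theorem isUnit_pairLocalizer {T : Triple n} (hT : T ∈ atomicLimits n) :
    IsUnit (pairLocalizer T) := by
  have h := hT.2.2.2.2.2.2.2.2.2
  rwa [isUnit_iff_isUnit_det, localizer_eq_reindex, det_reindex_self,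
    ← isUnit_iff_isUnit_det] at h

theorem pairLocalizer_continuous : Continuous (pairLocalizer : Triple n → _) := by
  refine continuous_matrix fun p q => ?_
  simp only [pairLocalizer, Matrix.add_apply, kroneckerMap_apply]
  have h1 : Continuous fun T : Triple n => T.1 p.1 q.1 := continuous_fst.matrix_elem _ _
  have h2 : Continuous fun T : Triple n => T.2.1 p.1 q.1 :=
    (continuous_fst.comp continuous_snd).matrix_elem _ _
  have h3 : Continuous fun T : Triple n => T.2.2 p.1 q.1 :=
    (continuous_snd.comp continuous_snd).matrix_elem _ _
  exact ((h1.mul continuous_const).add (h2.mul continuous_const)).add (h3.mul continuous_const)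

/-- For `H` real symmetric, `H ⊗ σy` is congruent to `1 ⊗ σy` by a matrix of determinant
`det H`. -/
theorem pairPf_pairLocalizer_zero_zero {H : Matrix (Fin (2 * n)) (Fin (2 * n)) ℂ}
    (hH : Hᵀ = H) :
    pairPf (pairLocalizer ((0, 0, H) : Triple n)) =
      H.det * pairPf (standardSkew (Fin (2 * n))) := by
  -- `K` is `H` on the first slot and `1` on the second. Since `σy` is off-diagonal, each of its
  -- nonzero entries picks up exactly one factor `H`.
  let P : Matrix (Fin 2) (Fin 2) ℂ := !![1, 0; 0, 0]
  let Q : Matrix (Fin 2) (Fin 2) ℂ := !![0, 0; 0, 1]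
  let K : Matrix (Fin (2 * n) × Fin 2) (Fin (2 * n) × Fin 2) ℂ := H ⊗ₖ P + 1 ⊗ₖ Q
  have hK : K.det = H.det := by
    have : K = blockDiagonal ![H, 1] := by
      ext ⟨i, s⟩ ⟨j, t⟩
      fin_cases s <;> fin_cases t <;> simp [K, P, Q, kroneckerMap_apply, blockDiagonal_apply]
    rw [this, det_blockDiagonal]
    simp
  rw [← hK, ← pairPf_congruence]
  congr 1
  have e1 : P * pauliY * P = 0 := by
    ext i j; fin_cases i <;> fin_cases j <;> simp [P, pauliY]
  have e2 : Q * pauliY * Q = 0 := by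
    ext i j; fin_cases i <;> fin_cases j <;> simp [Q, pauliY]
  have e3 : P * pauliY * Q + Q * pauliY * P = pauliY := by
    ext i j; fin_cases i <;> fin_cases j <;> simp [P, Q, pauliY]
  have hP : Pᵀ = P := by
    ext i j; fin_cases i <;> fin_cases j <;> simp [P]
  have hQ : Qᵀ = Q := by
    ext i j; fin_cases i <;> fin_cases j <;> simp [Q]
  simp only [K, standardSkew, pairLocalizer, transpose_add, ← kroneckerMap_transpose, hH, hP, hQ,
    transpose_one, add_mul, mul_add, ← mul_kronecker_mul, e1, e2, Matrix.mul_one, Matrix.one_mul,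
    kronecker_zero, zero_kronecker, zero_add, add_zero]
  rw [← kronecker_add, add_comm (Q * pauliY * P), e3]


/-! ### Deforming the position matrices to zero -/

section realParts

variable {κ : Type*} [Fintype κ] {A B : Matrix κ κ ℂ}

theorem im_mul_of_im_im (hA : ∀ i j, (A i j).im = 0) (hB : ∀ i j, (B i j).im = 0) (i j : κ) :
    ((A * B) i j).im = 0 := by
  simp [mul_apply, hA, hB]

theorem im_mul_of_re_re (hA : ∀ i j, (A i j).re = 0) (hB : ∀ i j, (B i j).re = 0) (i j : κ) :
    ((A * B) i j).im = 0 := by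
  simp [mul_apply, hA, hB]

theorem re_mul_of_im_re (hA : ∀ i j, (A i j).im = 0) (hB : ∀ i j, (B i j).re = 0) (i j : κ) :
    ((A * B) i j).re = 0 := by
  simp [mul_apply, hA, hB]

theorem re_mul_of_re_im (hA : ∀ i j, (A i j).re = 0) (hB : ∀ i j, (B i j).im = 0) (i j : κ) :
    ((A * B) i j).re = 0 := by
  simp [mul_apply, hA, hB]

end realParts

theorem isHermitian_real_smul {κ : Type*} {A : Matrix κ κ ℂ} (hA : A.IsHermitian) (r : ℝ) :
    (r • A).IsHermitian := by
  rw [IsHermitian, conjTranspose_smul, star_trivial, hA]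

/-- A matrix pencil that is invertible at one complex parameter is invertible at a real one. -/
theorem exists_real_isUnit_add_smul {κ : Type*} [Fintype κ] [DecidableEq κ] (H S : Matrix κ κ ℂ)
    (z : ℂ) (h : IsUnit (H + z • S)) : ∃ c : ℝ, IsUnit (H + c • S) := by
  -- The determinant of the pencil is a polynomial in the parameter; if it vanished on all of `ℝ` it
  -- would be zero.
  let p : Polynomial ℂ :=
    (Matrix.of fun i j => Polynomial.C (H i j) + Polynomial.X * Polynomial.C (S i j)).det
  have hp (w : ℂ) : p.eval w = (H + w • S).det := by
    rw [← Polynomial.coe_evalRingHom, RingHom.map_det]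
    congr 1
    ext i j
    simp
    exact mul_comm _ _
  by_contra! hc
  have hroot (c : ℝ) : p.IsRoot (c : ℂ) := by
    have := hc c
    rw [isUnit_iff_isUnit_det, isUnit_iff_ne_zero, not_not] at this
    rw [Polynomial.IsRoot, hp, ← this]
    congr 2
  have hp0 : p = 0 := by
    refine Polynomial.eq_zero_of_infinite_isRoot p ?_
    refine (Set.infinite_range_of_injective Complex.ofReal_injective).mono ?_
    rintro _ ⟨c, rfl⟩
    exact hroot c
  rw [isUnit_iff_isUnit_det, isUnit_iff_ne_zero, ← hp, hp0] at h
  simp at h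

theorem mem_symmetricTriples_zero_zero {H : Matrix (Fin (2 * n)) (Fin (2 * n)) ℂ}
    (hH : H.IsHermitian) (hr : ∀ i j, (H i j).im = 0) :
    ((0, 0, H) : Triple n) ∈ symmetricTriples n :=
  ⟨isHermitian_zero, isHermitian_zero, hH, by simp, by simp, hr, Commute.zero_left _,
    Commute.zero_left _, Commute.zero_left _⟩

theorem mem_atomicLimits_zero_zero {H : Matrix (Fin (2 * n)) (Fin (2 * n)) ℂ}
    (hH : H.IsHermitian) (hr : ∀ i j, (H i j).im = 0) (hu : ∀ v, H *ᵥ v = 0 → v = 0) :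
    ((0, 0, H) : Triple n) ∈ atomicLimits n :=
  mem_atomicLimits_iff.2 ⟨mem_symmetricTriples_zero_zero hH hr, fun v _ _ h => hu v h⟩

/-- Every atomic limit can be deformed to one with vanishing position matrices. -/
theorem exists_joinedIn_zero_zero {T : Triple n} (hT : T ∈ atomicLimits n) :
    ∃ H : Matrix (Fin (2 * n)) (Fin (2 * n)) ℂ, ((0, 0, H) : Triple n) ∈ atomicLimits n ∧
      JoinedIn (atomicLimits n) T (0, 0, H) := by
  obtain ⟨X, Y, H⟩ := T
  rw [mem_atomicLimits_iff] at hT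
  obtain ⟨⟨hX, hY, hH, rX, rY, rH, cXY, cXH, cYH⟩, hker⟩ := hT
  dsimp only at hX hY hH rX rY rH cXY cXH cYH hker
  let S := X * X + Y * Y
  have hS : S.IsHermitian := by
    simp only [S, IsHermitian, conjTranspose_add, conjTranspose_mul, hX.eq, hY.eq]
  have rS (i j) : (S i j).im = 0 := by
    simp only [S, Matrix.add_apply, Complex.add_im, im_mul_of_re_re rX rX, im_mul_of_re_re rY rY,
      add_zero]
  have cXS : Commute X S := ((Commute.refl X).mul_right (Commute.refl X)).add_right
    (cXY.mul_right cXY)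
  have cYS : Commute Y S := (cXY.symm.mul_right cXY.symm).add_right
    ((Commute.refl Y).mul_right (Commute.refl Y))
  have cHS : Commute H S := (cXH.symm.mul_right cXH.symm).add_right (cYH.symm.mul_right cYH.symm)
  have hS0 {v : Fin (2 * n) → ℂ} (h : S *ᵥ v = 0) : X *ᵥ v = 0 ∧ Y *ᵥ v = 0 := by
    have := sum_squares_mulVec_eq_zero (H := 0) hX hY isHermitian_zero (v := v)
      (by simpa [S] using h)
    exact ⟨this.1, this.2.1⟩
  -- `(H - iS)(H + iS) = H² + S²`, whose kernel is `ker H ∩ ker S = ker H ∩ ker X ∩ ker Y = 0`. The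
  -- zero summand below only fits the three-square lemma.
  have hunit : IsUnit (H + Complex.I • S) := by
    rw [isUnit_iff_forall_mulVec]
    intro v hv
    have h1 : (H * H + S * S + 0 * 0) *ᵥ v = 0 := by
      have : H * H + S * S + 0 * 0 = (H - Complex.I • S) * (H + Complex.I • S) := by
        simp only [sub_mul, mul_add, smul_mul_assoc, mul_smul_comm, smul_sub, smul_smul,
          Complex.I_mul_I, cHS.eq, mul_zero, neg_smul, one_smul]
        abel
      rw [this, ← mulVec_mulVec, hv, mulVec_zero]
    obtain ⟨hHv, hSv, -⟩ := sum_squares_mulVec_eq_zero hH hS isHermitian_zero h1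
    exact hker v (hS0 hSv).1 (hS0 hSv).2 hHv
  obtain ⟨c, hc⟩ := exists_real_isUnit_add_smul H S _ hunit
  rw [isUnit_iff_forall_mulVec] at hc
  -- For `t ≠ 1` a common kernel vector is killed by `X` and `Y`, hence by `S` and `H`; at `t = 1`
  -- the choice of `c` takes over.
  let f (t : ℝ) : Triple n := ((1 - t) • X, (1 - t) • Y, H + (t * c) • S)
  have hf : Continuous f := by fun_prop
  have hmem (t : ℝ) : f t ∈ atomicLimits n := by
    refine mem_atomicLimits_iff.2 ⟨⟨isHermitian_real_smul hX _, isHermitian_real_smul hY _,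
      hH.add (isHermitian_real_smul hS _), fun i j => ?_, fun i j => ?_, fun i j => ?_,
      (cXY.smul_left _).smul_right _, (cXH.add_right (cXS.smul_right _)).smul_left _,
      (cYH.add_right (cYS.smul_right _)).smul_left _⟩, fun v hXv hYv hHv => ?_⟩
    · simp [f, rX]
    · simp [f, rY]
    · simp [f, rH, rS]
    · by_cases ht : t = 1
      · subst ht
        exact hc v (by simpa [f] using hHv)
      · have ht' : 1 - t ≠ 0 := sub_ne_zero.2 (Ne.symm ht)
        simp only [f, smul_mulVec, smul_eq_zero, ht', false_or] at hXv hYv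
        refine hker v hXv hYv ?_
        have hSv : S *ᵥ v = 0 := by
          simp [S, add_mulVec, ← mulVec_mulVec, hXv, hYv]
        simpa [f, add_mulVec, smul_mulVec, hSv] using hHv
  have h1 : f 1 = (0, 0, H + c • S) := by simp [f]
  refine ⟨H + c • S, h1 ▸ hmem 1, JoinedIn.ofLine (f := f) hf.continuousOn ?_ h1 ?_⟩
  · simp [f]
  · rintro _ ⟨t, -, rfl⟩
    exact hmem t

/-! ### Orthogonal conjugation and diagonal triples -/

/-- Simultaneous conjugation of a triple. -/
def conjTriple (U : Matrix (Fin (2 * n)) (Fin (2 * n)) ℂ) (T : Triple n) : Triple n :=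
  (U * T.1 * Uᴴ, U * T.2.1 * Uᴴ, U * T.2.2 * Uᴴ)

theorem conjTriple_continuous (U : Matrix (Fin (2 * n)) (Fin (2 * n)) ℂ) :
    Continuous (conjTriple U) := by
  unfold conjTriple
  fun_prop

theorem conjTriple_mem {U : Matrix (Fin (2 * n)) (Fin (2 * n)) ℂ} (hU : Uᴴ * U = 1)
    (rU : ∀ i j, (U i j).im = 0) {T : Triple n} (hT : T ∈ atomicLimits n) :
    conjTriple U T ∈ atomicLimits n := by
  rw [mem_atomicLimits_iff] at hT ⊢
  obtain ⟨⟨hX, hY, hH, rX, rY, rH, cXY, cXH, cYH⟩, hker⟩ := hT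
  have rU' (i j) : (Uᴴ i j).im = 0 := by simp [rU]
  have hmul (A B : Matrix (Fin (2 * n)) (Fin (2 * n)) ℂ) :
      U * A * Uᴴ * (U * B * Uᴴ) = U * (A * B) * Uᴴ := by
    calc U * A * Uᴴ * (U * B * Uᴴ) = U * A * (Uᴴ * U) * B * Uᴴ := by noncomm_ring
      _ = _ := by rw [hU]; noncomm_ring
  have hcomm {A B : Matrix (Fin (2 * n)) (Fin (2 * n)) ℂ} (h : Commute A B) :
      Commute (U * A * Uᴴ) (U * B * Uᴴ) := by
    rw [Commute, SemiconjBy, hmul, hmul, h.eq]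
  have hzero {A : Matrix (Fin (2 * n)) (Fin (2 * n)) ℂ} {v : Fin (2 * n) → ℂ}
      (h : (U * A * Uᴴ) *ᵥ v = 0) : A *ᵥ (Uᴴ *ᵥ v) = 0 := by
    have := congrArg (Uᴴ *ᵥ ·) h
    simp only [mulVec_mulVec, mulVec_zero] at this ⊢
    rwa [← Matrix.mul_assoc, ← Matrix.mul_assoc, hU, Matrix.one_mul] at this
  refine ⟨⟨isHermitian_mul_mul_conjTranspose _ hX, isHermitian_mul_mul_conjTranspose _ hY,
    isHermitian_mul_mul_conjTranspose _ hH,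
    re_mul_of_re_im (re_mul_of_im_re rU rX) rU', re_mul_of_re_im (re_mul_of_im_re rU rY) rU',
    im_mul_of_im_im (im_mul_of_im_im rU rH) rU', hcomm cXY, hcomm cXH, hcomm cYH⟩,
    fun v h1 h2 h3 => ?_⟩
  have := hker _ (hzero h1) (hzero h2) (hzero h3)
  have h4 := congrArg (U *ᵥ ·) this
  simpa [mulVec_mulVec, mul_eq_one_comm.1 hU] using h4

theorem joinedIn_conjTriple {U : Matrix (Fin (2 * n)) (Fin (2 * n)) ℂ} (hU : Uᴴ * U = 1)
    (rU : ∀ i j, (U i j).im = 0) {T₁ T₂ : Triple n} (h : JoinedIn (atomicLimits n) T₁ T₂) :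
    JoinedIn (atomicLimits n) (conjTriple U T₁) (conjTriple U T₂) := by
  obtain ⟨γ, hγ⟩ := h
  exact ⟨γ.map (conjTriple_continuous U), fun t => conjTriple_mem hU rU (hγ t)⟩

/-- The triple `(0, 0, diag d)`. -/
def diagonalTriple (d : Fin (2 * n) → ℝ) : Triple n := (0, 0, diagonal fun k => (d k : ℂ))

theorem diagonalTriple_mem {d : Fin (2 * n) → ℝ} (hd : ∀ k, d k ≠ 0) :
    diagonalTriple d ∈ atomicLimits n := by
  refine mem_atomicLimits_zero_zero ?_ ?_ ?_
  · simp [IsHermitian, diagonal_conjTranspose, Pi.star_def]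
  · intro i j
    by_cases h : i = j <;> simp [h]
  · intro v hv
    funext k
    have := congrFun hv k
    simpa [mulVec_diagonal, hd k] using this

theorem diagonalTriple_continuous : Continuous (diagonalTriple : _ → Triple n) := by
  unfold diagonalTriple
  fun_prop

theorem joinedIn_diagonalTriple_of_mul_pos {d d' : Fin (2 * n) → ℝ} (h : ∀ k, 0 < d k * d' k) :
    JoinedIn (atomicLimits n) (diagonalTriple d) (diagonalTriple d') := by
  refine JoinedIn.ofLine (f := fun t : ℝ => diagonalTriple fun k => (1 - t) * d k + t * d' k)
    (diagonalTriple_continuous.comp (by fun_prop)).continuousOn (by simp) (by simp) ?_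
  rintro _ ⟨t, ⟨ht0, ht1⟩, rfl⟩
  refine diagonalTriple_mem fun k hk => ?_
  rcases mul_pos_iff.1 (h k) with ⟨h1, h2⟩ | ⟨h1, h2⟩
  · nlinarith [mul_nonneg (sub_nonneg.2 ht1) h1.le, mul_nonneg ht0 h2.le]
  · nlinarith [mul_nonneg (sub_nonneg.2 ht1) (neg_pos.2 h1).le, mul_nonneg ht0 (neg_pos.2 h2).le]

/-! ### Cancelling negative signs in pairs -/

/-- The diagonal sign vector with entries `-1` on `S` and `1` elsewhere. -/
def signVector (S : Finset (Fin (2 * n))) (k : Fin (2 * n)) : ℝ := if k ∈ S then -1 else 1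

/-- The Hermitian matrix with entries `i` and `-i` at `(a, b)` and `(b, a)`. -/
def imaginaryUnit (a b : Fin (2 * n)) : Matrix (Fin (2 * n)) (Fin (2 * n)) ℂ :=
  of fun k l => if k = a ∧ l = b then Complex.I else if k = b ∧ l = a then -Complex.I else 0

/-- Two negative signs can be removed at the same time. -/
theorem joinedIn_signVector_erase {S : Finset (Fin (2 * n))} {a b : Fin (2 * n)} (ha : a ∈ S)
    (hb : b ∈ S) (hab : a ≠ b) :
    JoinedIn (atomicLimits n) (diagonalTriple (signVector S))
      (diagonalTriple (signVector ((S.erase a).erase b))) := by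
  let d (s : ℝ) (k : Fin (2 * n)) : ℝ := if k = a ∨ k = b then s else signVector S k
  -- The diagonal part is the scalar `s` on the plane of `a`, `b`, so it commutes with
  -- `imaginaryUnit a b`. It degenerates only at `s = 0`, exactly on that plane, where
  -- `imaginaryUnit a b` is injective. The factor `1 - s ^ 2` vanishes at both ends `s = ±1`.
  let f (s : ℝ) : Triple n := ((1 - s ^ 2) • imaginaryUnit a b, 0, diagonal fun k => (d s k : ℂ))
  have hd : Continuous d := by
    refine continuous_pi fun k => ?_
    by_cases hk : k = a ∨ k = b
    · simpa [d, hk] using continuous_id'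
    · simpa [d, hk] using continuous_const
  have hf : Continuous f := by
    refine (by fun_prop : Continuous fun s : ℝ => (1 - s ^ 2) • imaginaryUnit a b).prodMk
      (continuous_const.prodMk ?_)
    exact (continuous_pi fun k => Complex.continuous_ofReal.comp
      ((continuous_apply k).comp hd)).matrix_diagonal
  have hI : (imaginaryUnit a b).IsHermitian := by
    ext k l
    simp only [imaginaryUnit, conjTranspose_apply, of_apply]
    have e₁ : star Complex.I = -Complex.I := Complex.conj_I
    have e₂ : star (-Complex.I) = Complex.I := by rw [star_neg, e₁, neg_neg]
    have e₃ : star (0 : ℂ) = 0 := star_zero ℂ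
    grind
  have hIre (k l) : (imaginaryUnit a b k l).re = 0 := by
    simp only [imaginaryUnit, of_apply]
    split_ifs <;> simp
  have hmem (s : ℝ) : f s ∈ atomicLimits n := by
    refine mem_atomicLimits_iff.2 ⟨⟨isHermitian_real_smul hI _, isHermitian_zero, ?_, fun i j => ?_,
      by simp [f], fun i j => ?_, Commute.zero_right _, ?_, Commute.zero_left _⟩,
      fun v h1 _ h3 => ?_⟩
    · simp [f, IsHermitian, diagonal_conjTranspose, Pi.star_def]
    · simp only [f, Matrix.smul_apply, Complex.smul_re, hIre, smul_zero]
    · by_cases h : i = j <;> simp [f, h]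
    · refine Commute.smul_left ?_ _
      rw [Commute, SemiconjBy]
      ext k l
      rw [mul_diagonal, diagonal_mul]
      simp only [imaginaryUnit, of_apply, d]
      grind
    · have h3' (k) : d s k = 0 ∨ v k = 0 := by
        have := congrFun h3 k
        simpa [f, mulVec_diagonal] using this
      have hcase (k) : k = a ∨ k = b ∨ v k = 0 := by
        by_contra! h
        have := h3' k
        simp only [d, h, signVector, or_self, if_false] at this
        split_ifs at this <;> simp at this
      have hrow_a : (imaginaryUnit a b *ᵥ v) a = Complex.I * v b := by
        simp [mulVec, dotProduct, imaginaryUnit, hab]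
      have hrow_b : (imaginaryUnit a b *ᵥ v) b = -Complex.I * v a := by
        simp [mulVec, dotProduct, imaginaryUnit, hab.symm]
      by_cases hs : s = 0
      · subst hs
        have h1' : imaginaryUnit a b *ᵥ v = 0 := by simpa [f] using h1
        rw [h1'] at hrow_a hrow_b
        have vb : v b = 0 := by simpa using hrow_a.symm
        have va : v a = 0 := by simpa using hrow_b.symm
        funext k
        rcases hcase k with rfl | rfl | h
        exacts [va, vb, h]
      · funext k
        rcases hcase k with rfl | rfl | h
        · simpa [d, hs] using h3' k
        · simpa [d, hs] using h3' k
        · exact h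
  refine JoinedIn.ofLine (f := fun t : ℝ => f (2 * t - 1)) (hf.comp (by fun_prop)).continuousOn
    ?_ ?_ ?_
  · have : d (-1) = signVector S := by
      funext k
      simp only [d, signVector]
      grind
    simp [f, diagonalTriple, this]
  · have : d 1 = signVector ((S.erase a).erase b) := by
      funext k
      simp only [d, signVector]
      grind
    norm_num [f, diagonalTriple, this]
  · rintro _ ⟨t, -, rfl⟩
    exact hmem _

theorem exists_joinedIn_signVector (S : Finset (Fin (2 * n))) :
    JoinedIn (atomicLimits n) (diagonalTriple (signVector S)) (diagonalTriple (signVector ∅)) ∨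
    ∃ a, JoinedIn (atomicLimits n) (diagonalTriple (signVector S))
      (diagonalTriple (signVector {a})) := by
  have hrefl (S : Finset (Fin (2 * n))) : JoinedIn (atomicLimits n)
      (diagonalTriple (signVector S)) (diagonalTriple (signVector S)) :=
    JoinedIn.refl (diagonalTriple_mem fun k => by unfold signVector; split_ifs <;> norm_num)
  induction S using Finset.strongInduction with
  | H S ih =>
    rcases lt_or_ge 1 S.card with h | h
    · obtain ⟨a, ha, b, hb, hab⟩ := Finset.one_lt_card.1 h
      have hj := joinedIn_signVector_erase ha hb hab
      rcases ih _ ((Finset.erase_subset _ _).trans_ssubset (Finset.erase_ssubset ha)) with h | ⟨c, h⟩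
      · exact Or.inl (hj.trans h)
      · exact Or.inr ⟨c, hj.trans h⟩
    · rcases S.eq_empty_or_nonempty with rfl | ⟨a, ha⟩
      · exact Or.inl (hrefl _)
      · have hS : S = {a} := Finset.eq_singleton_iff_unique_mem.2
          ⟨ha, fun b hb => Finset.card_le_one.1 h b hb a ha⟩
        exact Or.inr ⟨a, hS ▸ hrefl S⟩

/-! ### Reflections -/

/-- The triple `(0, 0, 1 - 2 u uᵀ)`. -/
def reflectionTriple (u : EuclideanSpace ℝ (Fin (2 * n))) : Triple n :=
  (0, 0, 1 - (2 : ℂ) • vecMulVec (fun k => (u k : ℂ)) (fun k => (u k : ℂ)))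

theorem reflectionTriple_continuous : Continuous (reflectionTriple : _ → Triple n) := by
  refine continuous_const.prodMk (continuous_const.prodMk (continuous_matrix fun i j => ?_))
  simp only [Matrix.sub_apply, Matrix.smul_apply, vecMulVec_apply]
  fun_prop

theorem reflectionTriple_mem {u : EuclideanSpace ℝ (Fin (2 * n))} (hu : ‖u‖ = 1) :
    reflectionTriple u ∈ atomicLimits n := by
  have hu' : ∑ k, (u k : ℂ) * (u k : ℂ) = 1 := by
    have := EuclideanSpace.real_norm_sq_eq u
    rw [hu] at this
    have h2 : ∑ k, u k * u k = 1 := by simpa [sq] using this.symm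
    exact_mod_cast h2
  refine mem_atomicLimits_zero_zero ?_ ?_ ?_
  · ext i j
    simp only [conjTranspose_apply, Matrix.sub_apply, Matrix.smul_apply, vecMulVec_apply, one_apply]
    by_cases h : i = j <;> simp [h, eq_comm, mul_comm]
  · intro i j
    simp only [Matrix.sub_apply, Matrix.smul_apply, vecMulVec_apply, one_apply]
    by_cases h : i = j <;> simp [h]
  · intro v hv
    set w : Fin (2 * n) → ℂ := fun k => (u k : ℂ) with hw
    have h1 (k) : v k = 2 * (w k * (w ⬝ᵥ v)) := by
      have := congrFun hv k
      rw [sub_mulVec, smul_mulVec, vecMulVec_mulVec, one_mulVec] at this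
      simpa [sub_eq_zero, mul_comm] using this
    have h2 : w ⬝ᵥ v = 2 * (w ⬝ᵥ v) := by
      calc w ⬝ᵥ v = ∑ k, w k * (2 * (w k * (w ⬝ᵥ v))) :=
            Finset.sum_congr rfl fun k _ => by rw [← h1 k]
        _ = 2 * ((∑ k, w k * w k) * (w ⬝ᵥ v)) := by
            rw [Finset.sum_mul, Finset.mul_sum]
            exact Finset.sum_congr rfl fun k _ => by ring
        _ = _ := by rw [hu', one_mul]
    have h3 : w ⬝ᵥ v = 0 := by linear_combination -h2
    funext k
    rw [h1 k, h3]
    simp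

/-- The unit sphere is path connected in dimension `2n ≥ 2`. This replaces connectedness of the
special orthogonal group. -/
theorem joinedIn_reflectionTriple (hn : 1 ≤ n) {u w : EuclideanSpace ℝ (Fin (2 * n))}
    (hu : ‖u‖ = 1) (hw : ‖w‖ = 1) :
    JoinedIn (atomicLimits n) (reflectionTriple u) (reflectionTriple w) := by
  have hrank : 1 < Module.rank ℝ (EuclideanSpace ℝ (Fin (2 * n))) := by
    rw [← Module.finrank_eq_rank, finrank_euclideanSpace_fin]
    exact_mod_cast (by omega : 1 < 2 * n)
  obtain ⟨γ, hγ⟩ := (isPathConnected_sphere hrank 0 zero_le_one).joinedIn u (by simpa using hu) w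
    (by simpa using hw)
  exact ⟨γ.map reflectionTriple_continuous, fun t => reflectionTriple_mem (by simpa using hγ t)⟩

theorem nontrivialTriple_eq (h : 0 < 2 * n) :
    nontrivialTriple n = reflectionTriple (EuclideanSpace.single ⟨0, h⟩ 1) := by
  refine Prod.ext rfl (Prod.ext rfl ?_)
  ext i j
  simp only [nontrivialTriple, reflectionTriple, diagonal_apply, Matrix.sub_apply,
    Matrix.smul_apply, vecMulVec_apply, one_apply]
  by_cases hij : i = j
  · subst hij
    by_cases h0 : (i : ℕ) = 0
    · norm_num [h0, Fin.ext_iff]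
    · simp [h0, Fin.ext_iff]
  · by_cases h0 : (i : ℕ) = 0
    · have : (j : ℕ) ≠ 0 := fun hj => hij (Fin.ext (h0.trans hj.symm))
      simp [hij, Fin.ext_iff, this]
    · simp [hij, Fin.ext_iff, h0]

theorem trivialTriple_mem : trivialTriple n ∈ atomicLimits n :=
  mem_atomicLimits_zero_zero isHermitian_one
    (fun i j => by by_cases h : i = j <;> simp [one_apply, h]) (fun v hv => by simpa using hv)

theorem nontrivialTriple_mem (hn : 1 ≤ n) : nontrivialTriple n ∈ atomicLimits n := by
  rw [nontrivialTriple_eq (by omega)]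
  exact reflectionTriple_mem (by simp)

/-! ### Reduction to the two base points -/

/-- A real symmetric matrix is diagonalized by a real orthogonal one. -/
theorem exists_real_diagonalization {H : Matrix (Fin (2 * n)) (Fin (2 * n)) ℂ}
    (hH : H.IsHermitian) (hr : ∀ i j, (H i j).im = 0) :
    ∃ (V : Matrix (Fin (2 * n)) (Fin (2 * n)) ℝ) (d : Fin (2 * n) → ℝ), Vᵀ * V = 1 ∧
      H = V.map Complex.ofReal * diagonal (fun k => (d k : ℂ)) * (V.map Complex.ofReal)ᴴ := by
  let R : Matrix (Fin (2 * n)) (Fin (2 * n)) ℝ := H.map Complex.re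
  have hHR : H = R.map Complex.ofReal := by
    ext i j
    exact Complex.ext (by simp [R]) (by simp [hr])
  have hR : R.IsHermitian := by
    ext i j
    have := congrArg Complex.re (congrFun (congrFun hH i) j)
    simpa [R] using this
  let V : Matrix (Fin (2 * n)) (Fin (2 * n)) ℝ := hR.eigenvectorUnitary
  have hV : star V * V = 1 := Unitary.coe_star_mul_self hR.eigenvectorUnitary
  refine ⟨V, hR.eigenvalues, ?_, ?_⟩
  · simpa [star_eq_conjTranspose, conjTranspose_eq_transpose_of_trivial] using hV
  · have hs := hR.spectral_theorem
    rw [Unitary.conjStarAlgAut_apply] at hs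
    have h2 := congrArg (fun A : Matrix _ _ ℝ => A.map Complex.ofReal) hs
    rw [← hHR] at h2
    refine h2.trans ?_
    change (V * _ * star V).map (Complex.ofRealHom : ℝ → ℂ) = _
    rw [Matrix.map_mul, Matrix.map_mul, diagonal_map (by simp)]
    congr 1
    ext i j
    simp

theorem joinedIn_trivial_or_nontrivial (hn : 1 ≤ n) {T : Triple n} (hT : T ∈ atomicLimits n) :
    JoinedIn (atomicLimits n) T (trivialTriple n) ∨
      JoinedIn (atomicLimits n) T (nontrivialTriple n) := by
  obtain ⟨H, hHmem, hTH⟩ := exists_joinedIn_zero_zero hT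
  obtain ⟨⟨-, -, hH, -, -, rH, -⟩, hker⟩ := mem_atomicLimits_iff.1 hHmem
  obtain ⟨V, d, hV, rfl⟩ := exists_real_diagonalization hH rH
  set U := V.map Complex.ofReal with hUdef
  have hU : Uᴴ * U = 1 := by
    have h1 : Uᴴ = Vᵀ.map Complex.ofReal := by
      ext i j
      simp [U]
    have h2 := Matrix.map_mul (L := Vᵀ) (M := V) (f := Complex.ofRealHom)
    rw [hV] at h2
    rw [h1]
    refine Eq.trans h2.symm ?_
    simp
  have hU' : U * Uᴴ = 1 := mul_eq_one_comm.1 hU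
  have rU (i j) : (U i j).im = 0 := by simp [U]
  have hconj (d : Fin (2 * n) → ℝ) : conjTriple U (diagonalTriple d) =
      (0, 0, U * diagonal (fun k => (d k : ℂ)) * Uᴴ) := by
    simp [conjTriple, diagonalTriple]
  rw [← hconj] at hTH
  -- A zero eigenvalue would make the column `U e_k` a kernel vector.
  have hd (k) : d k ≠ 0 := by
    intro hk
    have h0 : U *ᵥ Pi.single k 1 = 0 := by
      refine hker _ (by simp) (by simp) ?_
      dsimp only
      rw [← mulVec_mulVec, mulVec_mulVec _ Uᴴ, hU, one_mulVec, ← mulVec_mulVec]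
      have : diagonal (fun k => (d k : ℂ)) *ᵥ Pi.single k 1 = 0 := by
        funext l
        rw [mulVec_diagonal]
        by_cases h : l = k
        · subst h; simp [hk]
        · simp [h]
      rw [this, mulVec_zero]
    have h1 := congrArg (Uᴴ *ᵥ ·) h0
    simp only [mulVec_mulVec, hU, one_mulVec, mulVec_zero] at h1
    simpa using congrFun h1 k
  let S : Finset (Fin (2 * n)) := Finset.univ.filter fun k => d k < 0
  have hdS : JoinedIn (atomicLimits n) (diagonalTriple d) (diagonalTriple (signVector S)) := by
    refine joinedIn_diagonalTriple_of_mul_pos fun k => ?_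
    rcases lt_or_gt_of_ne (hd k) with h | h
    · simp [signVector, S, h]
    · simp [signVector, S, h, h.not_gt]
  -- Paths are conjugated by the fixed `U`, so `U` itself is never deformed and `det U` is
  -- irrelevant: `I` returns to `I`, and a single `-1` at `a` becomes the reflection along column
  -- `a` of `V`.
  have htriv : conjTriple U (diagonalTriple (signVector ∅)) = trivialTriple n := by
    simp [hconj, signVector, hU', trivialTriple]
  rcases exists_joinedIn_signVector S with h | ⟨a, h⟩
  · left
    exact htriv ▸ hTH.trans (joinedIn_conjTriple hU rU (hdS.trans h))
  · right
    have hTa := hTH.trans (joinedIn_conjTriple hU rU (hdS.trans h))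
    let u : EuclideanSpace ℝ (Fin (2 * n)) := WithLp.toLp 2 fun k => V k a
    have hrefl : conjTriple U (diagonalTriple (signVector {a})) = reflectionTriple u := by
      have hdiag : (diagonal fun k => ((signVector {a} k : ℝ) : ℂ)) =
          1 - (2 : ℂ) • vecMulVec (Pi.single a 1) (Pi.single a 1) := by
        ext i j
        simp only [diagonal_apply, Matrix.sub_apply, Matrix.smul_apply, vecMulVec_apply,
          one_apply, signVector, Finset.mem_singleton, Pi.single_apply]
        by_cases hij : i = j
        · subst hij
          by_cases h0 : i = a <;> norm_num [h0]
        · by_cases h0 : i = a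
          · subst h0; simp [hij, Ne.symm hij]
          · simp [hij, h0]
      rw [hconj, hdiag, mul_sub, sub_mul, Matrix.mul_one, hU', mul_smul_comm, smul_mul_assoc,
        mul_vecMulVec, vecMulVec_mul]
      refine Prod.ext rfl (Prod.ext rfl ?_)
      ext i j
      simp [reflectionTriple, vecMulVec_apply, U, u]
    have hu : ‖u‖ = 1 := by
      have h1 := EuclideanSpace.real_norm_sq_eq u
      have h2 : ∑ k, (u k) ^ 2 = 1 := by
        have := congrFun (congrFun hV a) a
        simpa [mul_apply, sq] using this
      rw [h2] at h1
      nlinarith [norm_nonneg u]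
    rw [hrefl] at hTa
    rw [nontrivialTriple_eq (by omega)]
    exact hTa.trans (joinedIn_reflectionTriple hn hu (by simp))


/-! ### The sign of the Pfaffian as a complete invariant -/

theorem pairPf_trivialTriple :
    pairPf (pairLocalizer (trivialTriple n)) = pairPf (standardSkew (Fin (2 * n))) := by
  rw [trivialTriple, pairPf_pairLocalizer_zero_zero transpose_one, det_one, one_mul]

theorem pairPf_nontrivialTriple (hn : 1 ≤ n) :
    pairPf (pairLocalizer (nontrivialTriple n)) = -pairPf (standardSkew (Fin (2 * n))) := by
  rw [nontrivialTriple, pairPf_pairLocalizer_zero_zero (diagonal_transpose _), det_diagonal,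
    Finset.prod_eq_single (⟨0, by omega⟩ : Fin (2 * n))]
  · simp
  · intro b _ hb
    have : (b : ℕ) ≠ 0 := fun h => hb (Fin.ext h)
    simp [this]
  · simp

theorem pairPf_ne_zero_of_joinedIn {T T' : Triple n} (h : JoinedIn (atomicLimits n) T T')
    (hT' : pairPf (pairLocalizer T') ≠ 0) : pairPf (pairLocalizer T) ≠ 0 := by
  obtain ⟨γ, hγ⟩ := h
  have := pairPf_ne_zero_of_path (fun t => pairLocalizer (γ t))
    (pairLocalizer_continuous.comp γ.continuous)
    (fun t => pairLocalizer_transpose (mem_atomicLimits_iff.1 (hγ t)).1)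
    (fun t => isUnit_pairLocalizer (hγ t)) (by simpa using hT')
  simpa using this

/-- Nonvanishing is carried along a path from whichever base point the triple reaches. -/
theorem pairPf_ne_zero (hn : 1 ≤ n) {T : Triple n} (hT : T ∈ atomicLimits n) :
    pairPf (pairLocalizer T) ≠ 0 := by
  rcases joinedIn_trivial_or_nontrivial hn hT with h | h
  · refine pairPf_ne_zero_of_joinedIn h ?_
    rw [pairPf_trivialTriple]
    exact pairPf_standardSkew_ne_zero
  · refine pairPf_ne_zero_of_joinedIn h ?_
    rw [pairPf_nontrivialTriple hn]
    exact neg_ne_zero.2 pairPf_standardSkew_ne_zero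

theorem pfaffian_localizer_ne_zero (hn : 1 ≤ n) {T : Triple n} (hT : T ∈ atomicLimits n) :
    pfaffian (localizer T) ≠ 0 := by
  obtain ⟨c, hc, hpf⟩ := exists_pfaffian_reindex (2 * n)
  rw [localizer_eq_reindex, hpf]
  exact mul_ne_zero (Complex.ofReal_ne_zero.2 hc) (pairPf_ne_zero hn hT)

theorem pfaffian_localizer_im {T : Triple n} (hT : T ∈ atomicLimits n) :
    (pfaffian (localizer T)).im = 0 := by
  obtain ⟨c, -, hpf⟩ := exists_pfaffian_reindex (2 * n)
  have hstar := star_pairPf _ (star_pairLocalizer (mem_atomicLimits_iff.1 hT).1)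
  rw [Fintype.card_fin, pow_mul, neg_one_sq, one_pow, one_mul] at hstar
  have him : (pairPf (pairLocalizer T)).im = 0 := Complex.conj_eq_iff_im.1 hstar
  rw [localizer_eq_reindex, hpf]
  simp [him]

theorem pfaffian_localizer_re_ne_zero (hn : 1 ≤ n) {T : Triple n} (hT : T ∈ atomicLimits n) :
    (pfaffian (localizer T)).re ≠ 0 := fun h =>
  pfaffian_localizer_ne_zero hn hT (Complex.ext h (pfaffian_localizer_im hT))

theorem localizer_transpose {T : Triple n} (hT : T ∈ atomicLimits n) :
    (localizer T)ᵀ = -localizer T := by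
  rw [localizer_eq_reindex, transpose_reindex,
    pairLocalizer_transpose (mem_atomicLimits_iff.1 hT).1]
  rfl

theorem pfaffian_localizer_continuous : Continuous fun T : Triple n => pfaffian (localizer T) := by
  obtain ⟨c, -, hpf⟩ := exists_pfaffian_reindex (2 * n)
  simp only [localizer_eq_reindex, hpf]
  exact continuous_const.mul (pairPf_continuous.comp pairLocalizer_continuous)

/-- The sign of a continuous nowhere vanishing real function is a continuous map to a discrete
space. -/
theorem pfaffianSign_eq_of_joinedIn (hn : 1 ≤ n) {T₁ T₂ : Triple n}
    (h : JoinedIn (atomicLimits n) T₁ T₂) : pfaffianSign T₁ = pfaffianSign T₂ := by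
  obtain ⟨γ, hγ⟩ := h
  have hcont : Continuous fun t => pfaffianSign (γ t) := by
    rw [continuous_iff_continuousAt]
    intro t
    have hre : Continuous fun t => (pfaffian (localizer (γ t))).re :=
      Complex.continuous_re.comp (pfaffian_localizer_continuous.comp γ.continuous)
    exact ContinuousAt.comp (f := fun t => (pfaffian (localizer (γ t))).re)
      (continuousAt_sign_of_ne_zero (pfaffian_localizer_re_ne_zero hn (hγ t))) hre.continuousAt
  simpa using PreconnectedSpace.constant inferInstance hcont (x := 0) (y := 1)

theorem pfaffianSign_nontrivialTriple (hn : 1 ≤ n) :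
    pfaffianSign (nontrivialTriple n) = -pfaffianSign (trivialTriple n) := by
  obtain ⟨c, -, hpf⟩ := exists_pfaffian_reindex (2 * n)
  rw [pfaffianSign, pfaffianSign, localizer_eq_reindex, localizer_eq_reindex, hpf, hpf,
    pairPf_trivialTriple, pairPf_nontrivialTriple hn, mul_neg, Complex.neg_re, Left.sign_neg]

theorem pfaffianSign_trivialTriple_ne (hn : 1 ≤ n) :
    pfaffianSign (trivialTriple n) ≠ pfaffianSign (nontrivialTriple n) := by
  rw [pfaffianSign_nontrivialTriple hn]
  have h : pfaffianSign (trivialTriple n) ≠ 0 :=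
    sign_ne_zero.2 (pfaffian_localizer_re_ne_zero hn trivialTriple_mem)
  revert h
  generalize pfaffianSign (trivialTriple n) = s
  revert s
  decide

theorem joinedIn_iff_pfaffianSign_eq (hn : 1 ≤ n) {T₁ T₂ : Triple n} (h₁ : T₁ ∈ atomicLimits n)
    (h₂ : T₂ ∈ atomicLimits n) :
    JoinedIn (atomicLimits n) T₁ T₂ ↔ pfaffianSign T₁ = pfaffianSign T₂ := by
  refine ⟨pfaffianSign_eq_of_joinedIn hn, fun h => ?_⟩
  have hne := pfaffianSign_trivialTriple_ne hn
  rcases joinedIn_trivial_or_nontrivial hn h₁ with j₁ | j₁ <;>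
    rcases joinedIn_trivial_or_nontrivial hn h₂ with j₂ | j₂
  · exact j₁.trans j₂.symm
  · rw [pfaffianSign_eq_of_joinedIn hn j₁, pfaffianSign_eq_of_joinedIn hn j₂] at h
    exact absurd h hne
  · rw [pfaffianSign_eq_of_joinedIn hn j₁, pfaffianSign_eq_of_joinedIn hn j₂] at h
    exact absurd h.symm hne
  · exact j₁.trans j₂.symm

end AtomicLimit

end

theorem mainTheorem1 (n : ℕ) (hn : 1 ≤ n) :
    -- on the space of atomic limits the sign of the Pfaffian is well defined and nonzero
    (∀ T ∈ AtomicLimit.atomicLimits n,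
      (AtomicLimit.localizer T).transpose = -AtomicLimit.localizer T ∧
      (AtomicLimit.pfaffian (AtomicLimit.localizer T)).im = 0 ∧
      AtomicLimit.pfaffian (AtomicLimit.localizer T) ≠ 0) ∧
    -- it is a complete invariant of path components
    (∀ T₁ ∈ AtomicLimit.atomicLimits n, ∀ T₂ ∈ AtomicLimit.atomicLimits n,
      (JoinedIn (AtomicLimit.atomicLimits n) T₁ T₂ ↔
        AtomicLimit.pfaffianSign T₁ = AtomicLimit.pfaffianSign T₂)) ∧
    -- there are exactly two path components, represented by `(0, 0, I)` and `(0, 0, D)`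
    AtomicLimit.trivialTriple n ∈ AtomicLimit.atomicLimits n ∧
    AtomicLimit.nontrivialTriple n ∈ AtomicLimit.atomicLimits n ∧
    ¬ JoinedIn (AtomicLimit.atomicLimits n)
      (AtomicLimit.trivialTriple n) (AtomicLimit.nontrivialTriple n) ∧
    (∀ T ∈ AtomicLimit.atomicLimits n,
      JoinedIn (AtomicLimit.atomicLimits n) T (AtomicLimit.trivialTriple n) ∨
      JoinedIn (AtomicLimit.atomicLimits n) T (AtomicLimit.nontrivialTriple n)) := by
  exact ⟨fun T hT => ⟨AtomicLimit.localizer_transpose hT, AtomicLimit.pfaffian_localizer_im hT,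
      AtomicLimit.pfaffian_localizer_ne_zero hn hT⟩,
    fun T₁ h₁ T₂ h₂ => AtomicLimit.joinedIn_iff_pfaffianSign_eq hn h₁ h₂,
    AtomicLimit.trivialTriple_mem, AtomicLimit.nontrivialTriple_mem hn,
    fun h => AtomicLimit.pfaffianSign_trivialTriple_ne hn
      (AtomicLimit.pfaffianSign_eq_of_joinedIn hn h),
    fun T hT => AtomicLimit.joinedIn_trivial_or_nontrivial hn hT⟩
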